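/- Let $V=\mathbb{F}_2^\omega$ be a vector space of countably infinite dimension over the two-element field. A subgroup $G$ of the group $\operatorname{Sym}(V)$ of all permutations of the set $V$ is called closed if it is closed in the topology of pointwise convergence, that is, if every $\pi\in\operatorname{Sym}(V)$ that agrees on each finite subset of $V$ with some element of $G$ belongs to $G$. Let $\operatorname{GL}(\omega,2)$ and $\operatorname{AGL}$ be the groups of linear and of affine permutations of $V$, and let $\operatorname{Sym}_0(V)$ be the stabiliser of $0$ in $\operatorname{Sym}(V)$. For first-order structures $A,B$ (in any languages) with the same underlying set, $B$ is a (first-order definable) reduct of $A$ if all basic relations of $B$ and all graphs of basic functions of $B$ are definable in $A$ by first-order formulas without parameters; $A$ and $B$ are (first-order) interdefinable if each is a reduct of the other. Then the following hold. 1. The closed groups $G$ with $\operatorname{GL}(\omega,2)\le G\le\operatorname{Sym}(V)$ are exactly the four groups $\operatorname{GL}(\omega,2)$, $\operatorname{AGL}$, $\operatorname{Sym}_0(V)$ and $\operatorname{Sym}(V)$, and these are pairwise distinct. 2. The following four structures with underlying set $V$ are reducts of the vector space $V$ and are pairwise not interdefinable: the vector space $V$ itself; the affine space, that is, $V$ with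 the ternary addition $(a,b,c)\mapsto a+b+c$; the set $V$ with the single unary relation $\{0\}$; the set $V$ with no relations or functions. Their automorphism groups are, respectively, $\operatorname{GL}(\omega,2)$, $\operatorname{AGL}$, $\operatorname{Sym}_0(V)$ and $\operatorname{Sym}(V)$. 3. Every reduct $R$ of the vector space $V$ is interdefinable with exactly one of these four structures, and $R$ is interdefinable with a given one of them if and only if it has the same automorphism group. -/

import Mathlib

universe u v u' v' w

/-! ### Closed permutation groups -/

/-- A subgroup `H` of `Sym(M)` is closed in the topology of pointwise convergence: every
permutation that agrees on each finite set with some element of `H` belongs to `H`. -/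
def IsClosedPermGroup {M : Type w} (H : Subgroup (Equiv.Perm M)) : Prop :=
  ∀ π : Equiv.Perm M, (∀ S : Finset M, ∃ σ ∈ H, ∀ x ∈ S, σ x = π x) → π ∈ H

/-! ### First-order structures on a fixed set, definability, automorphisms -/

/-- A first-order structure with underlying set `M`, in an arbitrary language. -/
structure StructureOn (M : Type w) where
  /-- the language of the structure -/
  lang : FirstOrder.Language.{u, v}
  /-- the interpretation of the symbols of the language -/
  str : lang.Structure M

namespace StructureOn

/-- A subset of a power of `M` is definable in `A` by a first-order formula without parameters. -/
def Defines {M : Type w} (A : StructureOn.{u, v, w} M) {α : Type} (s : Set (α → M)) : Prop :=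
  letI := A.str
  (∅ : Set M).Definable A.lang s

/-- `B` is a (first-order definable) reduct of `A`: it has the same underlying set, and all its
basic relations, and the graphs of all its basic functions, are definable in `A` without
parameters. -/
def IsReductOf {M : Type w} (B : StructureOn.{u', v', w} M) (A : StructureOn.{u, v, w} M) : Prop :=
  (∀ (n : ℕ) (f : B.lang.Functions n),
    A.Defines {x : Fin (n + 1) → M | B.str.funMap f (Fin.init x) = x (Fin.last n)}) ∧
  (∀ (n : ℕ) (r : B.lang.Relations n), A.Defines {x : Fin n → M | B.str.RelMap r x})

/-- Two structures on the same set are first-order interdefinable. -/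
def Interdefinable {M : Type w} (A : StructureOn.{u, v, w} M) (B : StructureOn.{u', v', w} M) :
    Prop :=
  A.IsReductOf B ∧ B.IsReductOf A

/-- The automorphism group of a structure on `M`, as a subgroup of `Sym(M)`. -/
def aut {M : Type w} (A : StructureOn.{u, v, w} M) : Subgroup (Equiv.Perm M) :=
  letI := A.str
  { carrier := {σ | ∃ e : A.lang.Equiv M M, e.toEquiv = σ}
    mul_mem' := by
      rintro _ _ ⟨e, rfl⟩ ⟨f, rfl⟩
      exact ⟨e.comp f, rfl⟩
    one_mem' := ⟨FirstOrder.Language.Equiv.refl A.lang M, rfl⟩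
    inv_mem' := by
      rintro _ ⟨e, rfl⟩
      exact ⟨e.symm, rfl⟩ }

end StructureOn

/-! ### The four groups -/

/-- The general linear group, as a group of permutations of the vectors. -/
def linearPerms (V : Type w) [AddCommGroup V] [Module (ZMod 2) V] :
    Subgroup (Equiv.Perm V) :=
  (MulAction.toPermHom (V ≃ₗ[ZMod 2] V) V).range

/-- The affine general linear group, as a group of permutations of the vectors. -/
def affinePerms (V : Type w) [AddCommGroup V] [Module (ZMod 2) V] :
    Subgroup (Equiv.Perm V) where
  carrier := {σ | ∃ e : V ≃ᵃ[ZMod 2] V, e.toEquiv = σ}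
  mul_mem' := by
    rintro _ _ ⟨e, rfl⟩ ⟨f, rfl⟩
    exact ⟨f.trans e, rfl⟩
  one_mem' := ⟨AffineEquiv.refl (ZMod 2) V, rfl⟩
  inv_mem' := by
    rintro _ ⟨e, rfl⟩
    exact ⟨e.symm, rfl⟩

/-- The groups `GL`, `AGL`, `Sym₀` (the stabiliser of `0`) and `Sym`. -/
def fourGroups (V : Type w) [AddCommGroup V] [Module (ZMod 2) V] :
    Fin 4 → Subgroup (Equiv.Perm V) :=
  ![linearPerms V, affinePerms V, MulAction.stabilizer (Equiv.Perm V) (0 : V), ⊤]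

/-! ### The four structures -/

/-- The function symbols of the language of vector spaces over `𝔽₂`. -/
inductive VecFunctions : ℕ → Type
  | zero : VecFunctions 0
  | neg : VecFunctions 1
  | smul (c : ZMod 2) : VecFunctions 1
  | add : VecFunctions 2

/-- The single ternary function symbol of the language of affine spaces over `𝔽₂`. -/
inductive AffFunctions : ℕ → Type
  | add₃ : AffFunctions 3

/-- A single unary relation symbol. -/
inductive UnaryRelations : ℕ → Type
  | pred : UnaryRelations 1

/-- The vector space `V` over `𝔽₂`, as a first-order structure. -/
def vectorSpaceStructure (V : Type w) [AddCommGroup V] [Module (ZMod 2) V] :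
    StructureOn.{0, 0, w} V where
  lang := ⟨VecFunctions, fun _ => Empty⟩
  str :=
    { funMap := fun {n} (f : VecFunctions n) =>
        match n, f with
        | _, .zero => fun _ => 0
        | _, .neg => fun x => -x 0
        | _, .smul c => fun x => c • x 0
        | _, .add => fun x => x 0 + x 1
      RelMap := fun r => r.elim }

/-- The affine space over `𝔽₂` obtained from `V`: the set `V` with the ternary addition. -/
def affineSpaceStructure (V : Type w) [AddCommGroup V] : StructureOn.{0, 0, w} V where
  lang := ⟨AffFunctions, fun _ => Empty⟩
  str :=
    { funMap := fun {n} (f : AffFunctions n) =>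
        match n, f with
        | _, .add₃ => fun x => x 0 + x 1 + x 2
      RelMap := fun r => r.elim }

/-- The set `V` with the single unary relation `{0}`. -/
def pointedSetStructure (V : Type w) [AddCommGroup V] : StructureOn.{0, 0, w} V where
  lang := ⟨fun _ => Empty, UnaryRelations⟩
  str :=
    { funMap := fun f => f.elim
      RelMap := fun {n} (r : UnaryRelations n) =>
        match n, r with
        | _, .pred => fun x => x 0 = 0 }

/-- The trivial structure on `V`, without any relations or functions. -/
def trivialStructure (V : Type w) : StructureOn.{0, 0, w} V where
  lang := FirstOrder.Language.empty
  str := { funMap := fun f => f.elim, RelMap := fun r => r.elim }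

/-- The vector space, the affine space, the set with the unary relation `{0}`, and the trivial
structure. -/
def fourStructures (V : Type w) [AddCommGroup V] [Module (ZMod 2) V] :
    Fin 4 → StructureOn.{0, 0, w} V :=
  ![vectorSpaceStructure V, affineSpaceStructure V, pointedSetStructure V, trivialStructure V]

/-! The engine is the algebraic closure of a finite set `S` under an overgroup `G` of GL: the points
with finite orbit under the pointwise stabiliser of `S`. Transvections fixing `S` move any vector
outside span(S) to any other such vector, so the closure lies in the finite set span(S), and the
stabiliser of `S` in `G` is transitive off the closure (`exists_apply_eq_of_notMem_algClosure`).

Let `G` fix 0. If `G` is n-transitive but not (n+1)-transitive on nonzero vectors, every n-set of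
nonzero vectors has an extra nonzero point in its closure. For n ≥ 3 this is impossible
(`IsTransitiveOnNonzero.succ_of_three_le`): all these closures have equal size, but an independent
set admits only its sum as an extra point, whereas the set formed by n-1 independent vectors and
their sum gets at least two. As 2-transitivity is automatic, `G` is either transitive for all n ≥ 3,
hence Sym₀ when closed, or not 3-transitive. Then x + y is the extra point in the closure of {x, y},
and `G` is linear.

If `G` moves 0, it is transitive on V, and its stabiliser of 0 is GL or Sym₀. The second case gives
Sym. In the first the closure of a triple has exactly four points, the fourth being x + y + z, so
`G` is AGL.

For reducts, a tuple is determined up to GL by its linear relations, so every structure whose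
automorphism group contains GL has finitely many definable sets in each arity. By Ryll-Nardzewski,
definable means automorphism-invariant, so such structures are interdefinable exactly when their
automorphism groups agree. These groups are closed, and the classification applies. -/

theorem mem_linearPerms_iff {V : Type w} [AddCommGroup V] [Module (ZMod 2) V]
    {σ : Equiv.Perm V} : σ ∈ linearPerms V ↔ ∀ x y, σ (x + y) = σ x + σ y := by
  constructor
  · rintro ⟨e, rfl⟩ x y
    exact map_add e x y
  · intro h
    refine ⟨LinearEquiv.ofBijective ((AddMonoidHom.mk' σ h).toZModLinearMap 2) σ.bijective, ?_⟩
    ext x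
    rfl

theorem add_self_of_zmod_two {V : Type w} [AddCommGroup V] [Module (ZMod 2) V] (x : V) :
    x + x = 0 := ZModModule.add_self x

theorem mem_affinePerms_iff {V : Type w} [AddCommGroup V] [Module (ZMod 2) V]
    {σ : Equiv.Perm V} :
    σ ∈ affinePerms V ↔ ∀ x y z, σ (x + y + z) = σ x + σ y + σ z := by
  constructor
  · rintro ⟨e, rfl⟩ x y z
    have key : ∀ u : V, e u = e.linear u + e 0 := by
      intro u
      have := e.map_vadd 0 u
      simpa using this
    change e (x + y + z) = e x + e y + e z
    rw [key (x + y + z), key x, key y, key z, map_add, map_add]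
    have := add_self_of_zmod_two (e 0)
    have hab : ∀ a b c d : V, a + d + (b + d) + (c + d) = a + b + c + d + (d + d) := by
      intro a b c d
      abel
    rw [hab, this, add_zero]
  · intro h
    have hadd : ∀ x y, (σ (x + y) + σ 0) = (σ x + σ 0) + (σ y + σ 0) := by
      intro x y
      have h1 := h x y 0
      rw [add_zero] at h1
      rw [h1]
      abel
    -- In characteristic 2, adding `σ 0` also subtracts it, leaving the linear part.
    have hlin : (Equiv.addRight (σ 0)) * σ ∈ linearPerms V := by
      rw [mem_linearPerms_iff]
      exact hadd
    obtain ⟨e, he⟩ := hlin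
    have he' : ∀ x, e x = σ x + σ 0 := fun x => DFunLike.congr_fun he x
    refine ⟨e.toAffineEquiv.trans (AffineEquiv.constVAdd (ZMod 2) V (σ 0)), ?_⟩
    ext x
    have h0 := add_self_of_zmod_two (σ 0)
    change σ 0 + e x = σ x
    rw [he', add_comm, add_assoc, h0, add_zero]

theorem linearPerms_apply_zero {V : Type w} [AddCommGroup V] [Module (ZMod 2) V]
    {σ : Equiv.Perm V} (h : σ ∈ linearPerms V) : σ 0 = 0 := by
  have := mem_linearPerms_iff.1 h 0 0
  simpa using this

/-! ### Transvections and linear algebra over the two-element field -/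

section Transvections

variable {V : Type w} [AddCommGroup V] [Module (ZMod 2) V]

theorem zmod_two_eq_zero_or_one (c : ZMod 2) : c = 0 ∨ c = 1 := by
  revert c; decide

/-- A functional separating a vector from a subspace not containing it. -/
theorem exists_functional_eq_one (W : Submodule (ZMod 2) V) {x : V} (hx : x ∉ W) :
    ∃ f : V →ₗ[ZMod 2] ZMod 2, f x = 1 ∧ ∀ w ∈ W, f w = 0 := by
  obtain ⟨f, hf, hW⟩ := Submodule.exists_le_ker_of_notMem hx
  exact ⟨f, (zmod_two_eq_zero_or_one (f x)).resolve_left hf, fun w hw => hW hw⟩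

/-- Over `𝔽₂`, two vectors outside a subspace can be separated from it simultaneously. -/
theorem exists_functional_eq_one_eq_one (W : Submodule (ZMod 2) V) {x y : V} (hx : x ∉ W)
    (hy : y ∉ W) : ∃ f : V →ₗ[ZMod 2] ZMod 2, f x = 1 ∧ f y = 1 ∧ ∀ w ∈ W, f w = 0 := by
  obtain ⟨f, hfx, hf⟩ := exists_functional_eq_one W hx
  obtain ⟨g, hgy, hg⟩ := exists_functional_eq_one W hy
  rcases zmod_two_eq_zero_or_one (f y) with hfy | hfy
  · rcases zmod_two_eq_zero_or_one (g x) with hgx | hgx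
    -- Here (f, g) takes the values (1, 0) at `x` and (0, 1) at `y`.
    · exact ⟨f + g, by simp [hfx, hgx], by simp [hfy, hgy],
        fun w hw => by simp [hf w hw, hg w hw]⟩
    · exact ⟨g, hgx, hgy, hg⟩
  · exact ⟨f, hfx, hfy, hf⟩

/-- Two vectors outside a subspace are swapped by a linear permutation fixing the subspace. -/
theorem exists_linearPerms_swap (W : Submodule (ZMod 2) V) {x y : V} (hx : x ∉ W)
    (hy : y ∉ W) :
    ∃ σ ∈ linearPerms V, (∀ w ∈ W, σ w = w) ∧ σ x = y ∧ σ y = x := by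
  obtain ⟨f, hfx, hfy, hf⟩ := exists_functional_eq_one_eq_one W hx hy
  have hxx := add_self_of_zmod_two x
  have hyy := add_self_of_zmod_two y
  -- The transvection along x + y: an involution because f(x + y) = 1 + 1 = 0.
  have hinv : Function.Involutive fun v : V => v + f v • (x + y) := by
    intro v
    have h11 : (1 : ZMod 2) + 1 = 0 := by decide
    have hv := add_self_of_zmod_two (f v • (x + y))
    simp only [map_add, map_smul, hfx, hfy, h11, smul_zero, add_zero]
    rw [add_assoc, hv, add_zero]
  refine ⟨hinv.toPerm, ?_, ?_, ?_, ?_⟩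
  · rw [mem_linearPerms_iff]
    intro a b
    simp only [Function.Involutive.coe_toPerm, map_add, add_smul]
    abel
  · intro w hw
    simp [hf w hw]
  · simp only [Function.Involutive.coe_toPerm, hfx, one_smul]
    rw [← add_assoc, hxx, zero_add]
  · simp only [Function.Involutive.coe_toPerm, hfy, one_smul]
    rw [add_comm x y, ← add_assoc, hyy, zero_add]

theorem finite_span_of_finite {S : Set V} (hS : S.Finite) :
    (Submodule.span (ZMod 2) S : Set V).Finite := by
  have := FiniteDimensional.span_of_finite (ZMod 2) hS
  have : Finite (Submodule.span (ZMod 2) S) := Module.finite_of_finite (ZMod 2)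
  exact Set.toFinite _

theorem exists_sum_eq_of_mem_span [DecidableEq V] {A : Finset V} {t : V}
    (ht : t ∈ Submodule.span (ZMod 2) (A : Set V)) : ∃ I ⊆ A, t = ∑ i ∈ I, i := by
  obtain ⟨f, -, hf⟩ := Submodule.mem_span_finset.1 ht
  refine ⟨A.filter fun a => f a = 1, Finset.filter_subset _ _, ?_⟩
  rw [← hf, Finset.sum_filter]
  refine Finset.sum_congr rfl fun a _ => ?_
  rcases zmod_two_eq_zero_or_one (f a) with h | h <;> simp [h]

theorem exists_linearIndepOn_card [Infinite V] (n : ℕ) :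
    ∃ A : Finset V, A.card = n ∧ LinearIndepOn (ZMod 2) id (A : Set V) := by
  refine exists_finset_linearIndependent_of_le_rank ?_
  have : ¬ Module.Finite (ZMod 2) V := fun _ =>
    not_finite_iff_infinite.2 ‹_› (Module.finite_of_finite (ZMod 2))
  rw [← Module.rank_lt_aleph0_iff, not_lt] at this
  exact (Cardinal.natCast_le_aleph0).trans this

end Transvections

/-! ### Algebraic closure with respect to a permutation group -/

/-- The algebraic closure of `S` with respect to a permutation group `G`: the set of those points
whose orbit under the pointwise stabiliser of `S` is finite. -/
def algClosure {M : Type w} (G : Subgroup (Equiv.Perm M)) (S : Set M) : Set M :=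
  {x | {y | ∃ g ∈ G, (∀ s ∈ S, g s = s) ∧ g x = y}.Finite}

section AlgClosure

variable {M : Type w} {G : Subgroup (Equiv.Perm M)}

theorem subset_algClosure (S : Set M) : S ⊆ algClosure G S := by
  intro x hx
  refine (Set.finite_singleton x).subset ?_
  rintro y ⟨g, -, hg, rfl⟩
  exact hg x hx

theorem apply_mem_algClosure_image {S : Set M} {g : Equiv.Perm M} (hg : g ∈ G) {x : M}
    (hx : x ∈ algClosure G S) : g x ∈ algClosure G (g '' S) := by
  have hx' : {y | ∃ h ∈ G, (∀ s ∈ S, h s = s) ∧ h x = y}.Finite := hx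
  refine (hx'.image g).subset ?_
  rintro y ⟨h, hh, hS, rfl⟩
  refine ⟨g⁻¹ (h (g x)), ⟨g⁻¹ * h * g, G.mul_mem (G.mul_mem (G.inv_mem hg) hh) hg, ?_, rfl⟩, ?_⟩
  · intro s hs
    have := hS (g s) ⟨s, hs, rfl⟩
    simp [Equiv.Perm.mul_apply, this]
  · simp

theorem algClosure_image {S : Set M} {g : Equiv.Perm M} (hg : g ∈ G) :
    algClosure G (g '' S) = g '' algClosure G S := by
  apply Set.Subset.antisymm
  · intro x hx
    have := apply_mem_algClosure_image (G.inv_mem hg) hx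
    rw [← Set.image_comp] at this
    have hid : (⇑g⁻¹ ∘ ⇑g) = id := by
      ext y
      simp
    rw [hid, Set.image_id] at this
    exact ⟨_, this, by simp⟩
  · rintro _ ⟨x, hx, rfl⟩
    exact apply_mem_algClosure_image hg hx

end AlgClosure

/-! ### Closures under overgroups of the linear group -/

section LinearAlgClosure

variable {V : Type w} [AddCommGroup V] [Module (ZMod 2) V] [Infinite V]
  {G : Subgroup (Equiv.Perm V)} (hG : linearPerms V ≤ G)
include hG

/-- A point outside the span is carried by transvections fixing `S` to every other point outside it,
and there are infinitely many since the span is finite. -/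
theorem algClosure_subset_span {S : Set V} (hS : S.Finite) :
    algClosure G S ⊆ Submodule.span (ZMod 2) S := by
  intro x hx
  by_contra hxS
  have hinf : ((Submodule.span (ZMod 2) S : Set V)ᶜ).Infinite :=
    (finite_span_of_finite hS).infinite_compl
  refine hinf (Set.Finite.subset hx ?_)
  intro y hy
  obtain ⟨σ, hσ, hfix, hxy, -⟩ := exists_linearPerms_swap (Submodule.span (ZMod 2) S) hxS hy
  exact ⟨σ, hG hσ, fun s hs => hfix s (Submodule.subset_span hs), hxy⟩

theorem finite_algClosure {S : Set V} (hS : S.Finite) : (algClosure G S).Finite :=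
  (finite_span_of_finite hS).subset (algClosure_subset_span hG hS)

omit [Infinite V] hG in
theorem exists_apply_notMem_span {S : Set V} (hS : S.Finite) {x : V}
    (hx : x ∉ algClosure G S) :
    ∃ g ∈ G, (∀ s ∈ S, g s = s) ∧ g x ∉ Submodule.span (ZMod 2) S := by
  by_contra! hcon
  refine hx ((finite_span_of_finite hS).subset ?_)
  rintro y ⟨g, hg, hfix, rfl⟩
  exact hcon g hg hfix

omit [Infinite V] in
-- Both points have infinite orbits over `S`, so each can first be moved out of the finite span; a
-- transvection then joins the two images.
theorem exists_apply_eq_of_notMem_algClosure {S : Set V} (hS : S.Finite) {x y : V}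
    (hx : x ∉ algClosure G S) (hy : y ∉ algClosure G S) :
    ∃ g ∈ G, (∀ s ∈ S, g s = s) ∧ g x = y := by
  obtain ⟨g, hg, hgS, hgx⟩ := exists_apply_notMem_span hS hx
  obtain ⟨h, hh, hhS, hhy⟩ := exists_apply_notMem_span hS hy
  obtain ⟨σ, hσ, hfix, hxy, -⟩ := exists_linearPerms_swap (Submodule.span (ZMod 2) S) hgx hhy
  refine ⟨h⁻¹ * σ * g, G.mul_mem (G.mul_mem (G.inv_mem hh) (hG hσ)) hg, fun s hs => ?_, ?_⟩
  · rw [Equiv.Perm.mul_apply, Equiv.Perm.mul_apply, hgS s hs,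
      hfix s (Submodule.subset_span hs), Equiv.Perm.inv_eq_iff_eq, hhS s hs]
  · rw [Equiv.Perm.mul_apply, Equiv.Perm.mul_apply, hxy, Equiv.Perm.inv_eq_iff_eq]

/-- If y lay outside the closure of `S`, some g fixing `S` would move it out of span(S). But g
preserves the closure of `S`, so g(T) stays in span(S), and g(y), being in the closure of g(T), does
too. -/
theorem algClosure_subset_algClosure {S T : Set V} (hS : S.Finite)
    (hTS : T ⊆ algClosure G S) : algClosure G T ⊆ algClosure G S := by
  intro y hy
  by_contra hyS
  obtain ⟨g, hg, hgS, hgy⟩ := exists_apply_notMem_span hS hyS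
  have himg : g '' S = S := by
    rw [Set.image_congr hgS, Set.image_id']
  have h1 : g '' T ⊆ algClosure G S := by
    rw [← himg, algClosure_image hg]
    exact Set.image_mono hTS
  have hT : T.Finite := (finite_algClosure hG hS).subset hTS
  have h2 := algClosure_subset_span hG (hT.image g) (apply_mem_algClosure_image hg hy)
  exact hgy (Submodule.span_le.2 (h1.trans (algClosure_subset_span hG hS)) h2)

end LinearAlgClosure

/-! ### Transitivity on nonzero vectors -/

/-- The group `G` acts transitively on the `n`-tuples of pairwise distinct nonzero vectors. -/
def IsTransitiveOnNonzero {V : Type w} [AddCommGroup V] (G : Subgroup (Equiv.Perm V))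
    (n : ℕ) : Prop :=
  ∀ a b : Fin n → V, Function.Injective a → Function.Injective b → (∀ i, a i ≠ 0) →
    (∀ i, b i ≠ 0) → ∃ g ∈ G, ∀ i, g (a i) = b i

section Transitivity

variable {V : Type w} [AddCommGroup V] {G : Subgroup (Equiv.Perm V)} {n : ℕ}

theorem IsTransitiveOnNonzero.exists_image_eq (h : IsTransitiveOnNonzero G n) {S T : Finset V}
    (hS : S.card = n) (hT : T.card = n) (hS0 : (0 : V) ∉ S) (hT0 : (0 : V) ∉ T) :
    ∃ g ∈ G, g '' (S : Set V) = T := by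
  let e := (S.equivFinOfCardEq hS).symm
  let f := (T.equivFinOfCardEq hT).symm
  obtain ⟨g, hg, hgi⟩ := h (fun i => (e i : V)) (fun i => (f i : V))
    (Subtype.val_injective.comp e.injective) (Subtype.val_injective.comp f.injective)
    (fun i h0 => hS0 (h0 ▸ (e i).2)) (fun i h0 => hT0 (h0 ▸ (f i).2))
  refine ⟨g, hg, ?_⟩
  ext x
  constructor
  · rintro ⟨s, hs, rfl⟩
    have := hgi (e.symm ⟨s, hs⟩)
    simp only [Equiv.apply_symm_apply] at this
    rw [this]
    exact (f _).2
  · intro hx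
    refine ⟨e (f.symm ⟨x, hx⟩), (e _).2, ?_⟩
    rw [hgi]
    simp

theorem IsTransitiveOnNonzero.ncard_algClosure_eq (h : IsTransitiveOnNonzero G n)
    {S T : Finset V} (hS : S.card = n) (hT : T.card = n) (hS0 : (0 : V) ∉ S)
    (hT0 : (0 : V) ∉ T) :
    (algClosure G (S : Set V)).ncard = (algClosure G (T : Set V)).ncard := by
  obtain ⟨g, hg, hgS⟩ := h.exists_image_eq hS hT hS0 hT0
  rw [← hgS, algClosure_image hg, Set.ncard_image_of_injective _ g.injective]

theorem zero_mem_algClosure (h0 : ∀ g ∈ G, g 0 = 0) (S : Set V) : (0 : V) ∈ algClosure G S := by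
  refine (Set.finite_singleton (0 : V)).subset ?_
  rintro y ⟨g, hg, -, rfl⟩
  exact h0 g hg

variable [Module (ZMod 2) V]

/-- The failure of `(n + 1)`-transitivity of an `n`-transitive group is witnessed by nontrivial
algebraic closures of all sets of size `n`. -/
theorem IsTransitiveOnNonzero.exists_mem_algClosure (hG : linearPerms V ≤ G)
    (h0 : ∀ g ∈ G, g 0 = 0) (h : IsTransitiveOnNonzero G n)
    (hn : ¬ IsTransitiveOnNonzero G (n + 1)) {S : Finset V} (hS : S.card = n)
    (hS0 : (0 : V) ∉ S) : ∃ t ∈ algClosure G (S : Set V), t ≠ 0 ∧ t ∉ S := by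
  classical
  by_contra! hcon
  refine hn fun a b ha hb ha0 hb0 => ?_
  let T : Finset V := Finset.univ.image fun i : Fin n => b i.castSucc
  have hbinj : Function.Injective fun i : Fin n => b i.castSucc :=
    hb.comp (Fin.castSucc_injective n)
  have hT : T.card = n := by
    rw [Finset.card_image_of_injective _ hbinj, Finset.card_univ, Fintype.card_fin]
  have hT0 : (0 : V) ∉ T := by
    simp only [T, Finset.mem_image, Finset.mem_univ, true_and, not_exists]
    exact fun i => hb0 _
  -- Absence of extra points for the single set `S` passes to `T`, which is conjugate to it.
  obtain ⟨k, hk, hkS⟩ := h.exists_image_eq hS hT hS0 hT0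
  have hclos : ∀ t ∈ algClosure G (T : Set V), t ≠ 0 → t ∈ T := by
    rw [← hkS, algClosure_image hk]
    rintro _ ⟨t, ht, rfl⟩ ht0
    have : k t ∈ (T : Set V) := by
      rw [← hkS]
      refine ⟨t, hcon t ht ?_, rfl⟩
      rintro rfl
      exact ht0 (h0 k hk)
    exact this
  obtain ⟨g, hg, hgab⟩ := h (fun i => a i.castSucc) (fun i => b i.castSucc)
    (ha.comp (Fin.castSucc_injective n)) hbinj (fun i => ha0 _) (fun i => hb0 _)
  have hx : g (a (Fin.last n)) ∉ algClosure G (T : Set V) := by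
    intro hmem
    have h1 := hclos _ hmem fun h1 => ha0 (Fin.last n) (g.injective (h1.trans (h0 g hg).symm))
    simp only [T, Finset.mem_image, Finset.mem_univ, true_and] at h1
    obtain ⟨i, hi⟩ := h1
    rw [← hgab i] at hi
    exact (Fin.castSucc_lt_last i).ne (ha (g.injective hi))
  have hy : b (Fin.last n) ∉ algClosure G (T : Set V) := by
    intro hmem
    have h1 := hclos _ hmem (hb0 _)
    simp only [T, Finset.mem_image, Finset.mem_univ, true_and] at h1
    obtain ⟨i, hi⟩ := h1
    exact (Fin.castSucc_lt_last i).ne (hb hi)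
  -- `g` matches the first n entries; the last one is corrected by an element fixing `T`.
  obtain ⟨f, hf, hfT, hfx⟩ :=
    exists_apply_eq_of_notMem_algClosure hG (Finset.finite_toSet T) hx hy
  refine ⟨f * g, G.mul_mem hf hg, fun i => ?_⟩
  refine Fin.lastCases hfx (fun i => ?_) i
  rw [Equiv.Perm.mul_apply, hgab i]
  exact hfT _ (by simp [T])

variable [Infinite V]

/-- An exchange argument. If t omits some d in `A`, replace d by t: the new set has its closure
inside that of `A`, and by cardinality equal to it. Then d would lie in the span of the remaining
vectors of `A`. -/
theorem eq_sum_of_mem_algClosure [DecidableEq V] (hG : linearPerms V ≤ G) {A : Finset V}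
    (hA : LinearIndepOn (ZMod 2) id (A : Set V)) {t : V} (ht : t ∈ algClosure G (A : Set V))
    (hcard : ∀ d ∈ A, (algClosure G (A : Set V)).ncard ≤
      (algClosure G ((insert t (A.erase d) : Finset V) : Set V)).ncard) :
    t = ∑ a ∈ A, a := by
  obtain ⟨I, hIA, htI⟩ := exists_sum_eq_of_mem_span
    (algClosure_subset_span hG (Finset.finite_toSet A) ht)
  by_cases hI : I = A
  · rw [htI, hI]
  exfalso
  obtain ⟨d, hdA, hdI⟩ := Finset.exists_of_ssubset (hIA.ssubset_of_ne hI)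
  have htspan : t ∈ Submodule.span (ZMod 2) ((A.erase d : Finset V) : Set V) := by
    rw [htI]
    exact Submodule.sum_mem _ fun i hi => Submodule.subset_span
      (Finset.mem_coe.2 (Finset.mem_erase.2 ⟨fun hid => hdI (hid ▸ hi), hIA hi⟩))
  set T : Finset V := insert t (A.erase d) with hT_def
  have hTsub : (T : Set V) ⊆ algClosure G (A : Set V) := by
    intro x hx
    rcases Finset.mem_insert.1 (Finset.mem_coe.1 hx) with rfl | hx
    · exact ht
    · exact subset_algClosure _ (Finset.mem_of_mem_erase hx)
  have heq : algClosure G (T : Set V) = algClosure G (A : Set V) :=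
    Set.eq_of_subset_of_ncard_le
      (algClosure_subset_algClosure hG (Finset.finite_toSet A) hTsub)
      (hcard d hdA) (finite_algClosure hG (Finset.finite_toSet A))
  have hd : d ∈ Submodule.span (ZMod 2) (T : Set V) := by
    refine algClosure_subset_span hG (Finset.finite_toSet T) ?_
    rw [heq]
    exact subset_algClosure _ hdA
  have hTspan : Submodule.span (ZMod 2) (T : Set V) ≤
      Submodule.span (ZMod 2) ((A.erase d : Finset V) : Set V) := by
    rw [Submodule.span_le, hT_def, Finset.coe_insert, Set.insert_subset_iff]
    exact ⟨htspan, Submodule.subset_span⟩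
  have := LinearIndepOn.notMem_span hA (Finset.mem_coe.2 hdA)
  rw [Set.image_id, ← Finset.coe_erase] at this
  exact this (hTspan hd)

omit [Infinite V] in
theorem LinearIndepOn.eq_of_sum_eq_sum [DecidableEq V] {A I J : Finset V}
    (hA : LinearIndepOn (ZMod 2) id (A : Set V)) (hI : I ⊆ A) (hJ : J ⊆ A)
    (h : ∑ i ∈ I, i = ∑ j ∈ J, j) : I = J := by
  have key := linearIndepOn_finset_iff.1 hA
    (fun a => (if a ∈ I then 1 else 0) - (if a ∈ J then 1 else 0)) (by
      simp only [id, sub_smul, ite_smul, one_smul, zero_smul, Finset.sum_sub_distrib,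
        Finset.sum_ite_mem, Finset.inter_eq_right.2 hI, Finset.inter_eq_right.2 hJ, h, sub_self])
  ext a
  by_cases haI : a ∈ I <;> by_cases haJ : a ∈ J <;> simp only [haI, haJ]
  · simpa [haI, haJ] using key a (hI haI)
  · simpa [haI, haJ] using key a (hJ haJ)

/-- Double counting: under n-transitivity all n-sets of nonzero vectors have closures of one size,
yet without (n+1)-transitivity an independent set has at most n + 2 points in its closure and a
suitable dependent set at least n + 3. -/
theorem IsTransitiveOnNonzero.succ_of_three_le (hG : linearPerms V ≤ G)
    (h0 : ∀ g ∈ G, g 0 = 0) (h3 : 3 ≤ n) (h : IsTransitiveOnNonzero G n) :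
    IsTransitiveOnNonzero G (n + 1) := by
  classical
  by_contra hn
  -- for an independent set the closure has at most `n + 2` elements
  obtain ⟨B, hB, hBi⟩ := exists_linearIndepOn_card (V := V) n
  have hB0 : (0 : V) ∉ B := fun h0 => hBi.ne_zero h0 rfl
  have hle : (algClosure G (B : Set V)).ncard ≤ n + 2 := by
    have hsub : algClosure G (B : Set V) ⊆
        (insert 0 (insert (∑ a ∈ B, a) B) : Finset V) := by
      intro t ht
      rw [Finset.mem_coe, Finset.mem_insert, Finset.mem_insert]
      by_contra! hcon
      refine hcon.2.1 (eq_sum_of_mem_algClosure hG hBi ht fun d hd => ?_)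
      refine (h.ncard_algClosure_eq hB ?_ hB0 ?_).le
      · rw [Finset.card_insert_of_notMem fun h1 => hcon.2.2 (Finset.mem_of_mem_erase h1),
          Finset.card_erase_add_one hd, hB]
      · simp [hcon.1.symm, hB0]
    calc _ ≤ _ := Set.ncard_le_ncard hsub (Finset.finite_toSet _)
      _ = _ := Set.ncard_coe_finset _
      _ ≤ _ := (Finset.card_insert_le _ _).trans
        (Nat.succ_le_succ ((Finset.card_insert_le _ _).trans (by rw [hB])))
  -- for a suitable dependent set it has at least `n + 3` elements
  obtain ⟨A, hA, hAi⟩ := exists_linearIndepOn_card (V := V) (n - 1)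
  have hA0 : (0 : V) ∉ A := fun h0 => hAi.ne_zero h0 rfl
  have hspan : ∀ c ∈ A, ∀ J ⊆ A, c ∉ J → c ∉ Submodule.span (ZMod 2) (J : Set V) := by
    intro c hc J hJ hcJ hmem
    have h1 := LinearIndepOn.notMem_span hAi (Finset.mem_coe.2 hc)
    rw [Set.image_id] at h1
    refine h1 (Submodule.span_mono (fun j hj => ?_) hmem)
    exact ⟨hJ hj, fun hjd => hcJ (hjd ▸ hj)⟩
  have hsumA : ∑ a ∈ A, a ∉ A := by
    intro hmem
    have h1 : A = {∑ a ∈ A, a} :=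
      hAi.eq_of_sum_eq_sum subset_rfl (Finset.singleton_subset_iff.2 hmem) (by simp)
    have h2 := congrArg Finset.card h1
    rw [Finset.card_singleton] at h2
    omega
  -- `A` has n - 1 ≥ 2 elements, so its sum is nonzero and outside `A`.
  set S : Finset V := insert (∑ a ∈ A, a) A with hS_def
  have hScard : S.card = n := by
    rw [hS_def, Finset.card_insert_of_notMem hsumA, hA]
    omega
  have hS0 : (0 : V) ∉ S := by
    rw [hS_def, Finset.mem_insert, not_or]
    refine ⟨fun hs => ?_, hA0⟩
    have h1 : A = ∅ :=
      hAi.eq_of_sum_eq_sum subset_rfl (Finset.empty_subset _) (by simp [← hs])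
    rw [h1, Finset.card_empty] at hA
    omega
  obtain ⟨t, ht, ht0, htS⟩ := h.exists_mem_algClosure hG h0 hn hScard hS0
  have htA : t ∈ Submodule.span (ZMod 2) (A : Set V) := by
    refine Submodule.span_le.2 ?_ (algClosure_subset_span hG (Finset.finite_toSet S) ht)
    rw [hS_def, Finset.coe_insert, Set.insert_subset_iff]
    exact ⟨Submodule.sum_mem _ fun i hi => Submodule.subset_span hi, Submodule.subset_span⟩
  obtain ⟨I, hIA, htI⟩ := exists_sum_eq_of_mem_span htA
  have hIne : I.Nonempty := by
    rw [Finset.nonempty_iff_ne_empty]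
    rintro rfl
    exact ht0 (by simpa using htI)
  have hIA' : I ≠ A := by
    rintro rfl
    exact htS (by rw [htI, hS_def]; exact Finset.mem_insert_self _ _)
  obtain ⟨i, hi⟩ := hIne
  obtain ⟨d, hdA, hdI⟩ := Finset.exists_of_ssubset (hIA.ssubset_of_ne hIA')
  -- Swapping i in `I` with d outside `I` preserves `A` and its sum, hence `S`, but moves t: this
  -- yields a second extra point.
  obtain ⟨σ, hσ, hfix, hid, hdi⟩ := exists_linearPerms_swap
    (Submodule.span (ZMod 2) (((A.erase i).erase d : Finset V) : Set V))
    (hspan i (hIA hi) _ ((Finset.erase_subset _ _).trans (Finset.erase_subset _ _))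
      (by simp)) (hspan d hdA _ ((Finset.erase_subset _ _).trans (Finset.erase_subset _ _))
      (by simp))
  have hσA : A.image σ = A := by
    refine Finset.eq_of_subset_of_card_le ?_
      (Finset.card_image_of_injective _ σ.injective).ge
    intro x hx
    obtain ⟨a, ha, rfl⟩ := Finset.mem_image.1 hx
    by_cases hai : a = i
    · rwa [hai, hid]
    by_cases had : a = d
    · rw [had, hdi]
      exact hIA hi
    · rwa [hfix a (Submodule.subset_span (by simp [hai, had, ha]))]
  have hσsum : ∀ J : Finset V, σ (∑ j ∈ J, j) = ∑ j ∈ J.image σ, j := by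
    intro J
    obtain ⟨e, rfl⟩ := hσ
    rw [Finset.sum_image fun x _ y _ hxy => Equiv.injective _ hxy]
    exact map_sum e _ _
  have hσS : S.image σ = S := by
    rw [hS_def, Finset.image_insert, hσsum, hσA]
  have hσtS : σ t ∉ S := by
    rw [← hσS]
    intro hmem
    obtain ⟨x, hx, hxt⟩ := Finset.mem_image.1 hmem
    exact htS (σ.injective hxt ▸ hx)
  have hσt0 : σ t ≠ 0 := fun h1 =>
    ht0 (σ.injective (h1.trans (linearPerms_apply_zero hσ).symm))
  have hσt : t ≠ σ t := by
    intro h1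
    rw [htI, hσsum] at h1
    have h2 := hAi.eq_of_sum_eq_sum hIA (hσA ▸ Finset.image_subset_image hIA) h1
    rw [h2] at hi
    obtain ⟨x, hx, hxi⟩ := Finset.mem_image.1 hi
    rw [← hdi] at hxi
    exact hdI (σ.injective hxi ▸ hx)
  have hσtmem : σ t ∈ algClosure G (S : Set V) := by
    have h1 := apply_mem_algClosure_image (hG hσ) ht
    rwa [← Finset.coe_image, hσS] at h1
  have hge : n + 3 ≤ (algClosure G (S : Set V)).ncard := by
    have hsub : ((insert 0 (insert t (insert (σ t) S)) : Finset V) : Set V) ⊆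
        algClosure G (S : Set V) := by
      simp only [Finset.coe_insert, Set.insert_subset_iff]
      exact ⟨zero_mem_algClosure h0 _, ht, hσtmem, subset_algClosure _⟩
    calc n + 3 = (insert 0 (insert t (insert (σ t) S)) : Finset V).card := by
          rw [Finset.card_insert_of_notMem, Finset.card_insert_of_notMem,
            Finset.card_insert_of_notMem hσtS, hScard]
          · simp [hσt, htS]
          · simp [ht0.symm, hσt0.symm, hS0]
      _ = _ := (Set.ncard_coe_finset _).symm
      _ ≤ _ := Set.ncard_le_ncard hsub (finite_algClosure hG (Finset.finite_toSet S))
  have := h.ncard_algClosure_eq hB hScard hB0 hS0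
  omega

/-- The closures of ∅ and {x} lie in {0} and {0, x}, leaving no room for an extra point. -/
theorem isTransitiveOnNonzero_two (hG : linearPerms V ≤ G) (h0 : ∀ g ∈ G, g 0 = 0) :
    IsTransitiveOnNonzero G 2 := by
  have hzero : IsTransitiveOnNonzero G 0 := fun a b _ _ _ _ =>
    ⟨1, G.one_mem, fun i => i.elim0⟩
  have hone : IsTransitiveOnNonzero G 1 := by
    by_contra hn
    obtain ⟨t, ht, ht0, -⟩ :=
      hzero.exists_mem_algClosure hG h0 hn (S := ∅) Finset.card_empty (by simp)
    have := algClosure_subset_span hG (Finset.finite_toSet _) ht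
    simp at this
    exact ht0 this
  by_contra hn
  obtain ⟨x, hx⟩ := exists_ne (0 : V)
  obtain ⟨t, ht, ht0, htx⟩ :=
    hone.exists_mem_algClosure hG h0 hn (S := {x}) (Finset.card_singleton _)
      (by simpa using hx.symm)
  have := algClosure_subset_span hG (Finset.finite_toSet _) ht
  rw [Finset.coe_singleton, SetLike.mem_coe, Submodule.mem_span_singleton] at this
  obtain ⟨c, rfl⟩ := this
  rcases zmod_two_eq_zero_or_one c with rfl | rfl
  · simp at ht0
  · simp at htx

omit [Infinite V] in
theorem mem_span_pair_iff {x y t : V} : t ∈ Submodule.span (ZMod 2) ({x, y} : Set V) ↔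
    t = 0 ∨ t = x ∨ t = y ∨ t = x + y := by
  rw [Submodule.mem_span_pair]
  constructor
  · rintro ⟨a, b, rfl⟩
    rcases zmod_two_eq_zero_or_one a with rfl | rfl <;>
      rcases zmod_two_eq_zero_or_one b with rfl | rfl <;> simp
  · rintro (rfl | rfl | rfl | rfl)
    · exact ⟨0, 0, by simp⟩
    · exact ⟨1, 0, by simp⟩
    · exact ⟨0, 1, by simp⟩
    · exact ⟨1, 1, by simp⟩

/-- A `2`-transitive but not `3`-transitive overgroup of the linear group is linear. -/
theorem IsTransitiveOnNonzero.le_linearPerms (hG : linearPerms V ≤ G)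
    (h0 : ∀ g ∈ G, g 0 = 0) (h : IsTransitiveOnNonzero G 2)
    (hn : ¬ IsTransitiveOnNonzero G 3) : G ≤ linearPerms V := by
  classical
  have hclos : ∀ x y : V, x ≠ 0 → y ≠ 0 → x ≠ y →
      ∀ t ∈ algClosure G ({x, y} : Set V), t = 0 ∨ t = x ∨ t = y ∨ t = x + y := by
    intro x y _ _ _ t ht
    exact mem_span_pair_iff.1 (algClosure_subset_span hG (Set.toFinite _) ht)
  have hadd : ∀ x y : V, x ≠ 0 → y ≠ 0 → x ≠ y → x + y ∈ algClosure G ({x, y} : Set V) := by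
    intro x y hx hy hxy
    obtain ⟨t, ht, ht0, htS⟩ := h.exists_mem_algClosure hG h0 hn (S := {x, y})
      (Finset.card_pair hxy) (by simp [hx.symm, hy.symm])
    rw [Finset.coe_pair] at ht
    simp only [Finset.mem_insert, Finset.mem_singleton, not_or] at htS
    rcases hclos x y hx hy hxy t ht with h1 | h1 | h1 | h1
    · exact (ht0 h1).elim
    · exact (htS.1 h1).elim
    · exact (htS.2 h1).elim
    · exact h1 ▸ ht
  intro g hg
  rw [mem_linearPerms_iff]
  have hg0 := h0 g hg
  have hne : ∀ x, x ≠ 0 → g x ≠ 0 := fun x hx h1 => hx (g.injective (h1.trans hg0.symm))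
  intro x y
  by_cases hx : x = 0
  · simp [hx, hg0]
  by_cases hy : y = 0
  · simp [hy, hg0]
  by_cases hxy : x = y
  · rw [hxy, add_self_of_zmod_two, add_self_of_zmod_two, hg0]
  have h1 := apply_mem_algClosure_image hg (hadd x y hx hy hxy)
  rw [Set.image_pair] at h1
  rcases hclos _ _ (hne x hx) (hne y hy) (g.injective.ne hxy) _ h1 with h2 | h2 | h2 | h2
  · rw [← hg0] at h2
    have h3 : x + y = y + y := (g.injective h2).trans (add_self_of_zmod_two y).symm
    exact (hxy (add_right_cancel h3)).elim
  · exact (hy (by simpa using g.injective h2)).elim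
  · exact (hx (by simpa using g.injective h2)).elim
  · exact h2

end Transitivity

/-! ### The classification of the closed groups -/

section Classification

variable {V : Type w} [AddCommGroup V] [Module (ZMod 2) V] [Infinite V]
  {G : Subgroup (Equiv.Perm V)}

theorem eq_linearPerms_or_eq_stabilizer (hG : linearPerms V ≤ G) (hcl : IsClosedPermGroup G)
    (h0 : ∀ g ∈ G, g 0 = 0) :
    G = linearPerms V ∨ G = MulAction.stabilizer (Equiv.Perm V) (0 : V) := by
  classical
  have h2 := isTransitiveOnNonzero_two hG h0
  by_cases h3 : IsTransitiveOnNonzero G 3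
  · right
    have hall : ∀ n, IsTransitiveOnNonzero G (n + 3) := fun n =>
      Nat.rec h3 (fun n hn => hn.succ_of_three_le hG h0 (by omega)) n
    refine le_antisymm (fun g hg => h0 g hg) fun π hπ => hcl π fun S => ?_
    have hπ0 : π 0 = 0 := hπ
    -- enlarge `S` to a set with at least four elements
    obtain ⟨B, hSB, hB⟩ := Infinite.exists_superset_card_eq (S.erase 0 ∪ {0})
      ((S.erase 0 ∪ {0}).card + 3) (by omega)
    have h0B : (0 : V) ∈ B := hSB (by simp)
    -- With k ≥ 1 elements in the union, erasing 0 from `B` leaves k + 2 = (k - 1) + 3.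
    have hcard : ∃ n, (B.erase 0).card = n + 3 := by
      have h1 : 1 ≤ (S.erase 0 ∪ {0}).card := Finset.card_pos.2 ⟨0, by simp⟩
      exact ⟨(S.erase 0 ∪ {0}).card - 1, by rw [Finset.card_erase_of_mem h0B]; omega⟩
    obtain ⟨n, hn⟩ := hcard
    let e := ((B.erase 0).equivFinOfCardEq hn).symm
    have he0 : ∀ i, (e i : V) ≠ 0 := fun i => (Finset.mem_erase.1 (e i).2).1
    have heinj : Function.Injective fun i => (e i : V) :=
      Subtype.val_injective.comp e.injective
    obtain ⟨g, hg, hge⟩ := hall n (fun i => (e i : V)) (fun i => π (e i)) heinj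
      (π.injective.comp heinj) he0 fun i h1 => he0 i (π.injective (h1.trans hπ0.symm))
    refine ⟨g, hg, fun x hx => ?_⟩
    by_cases hx0 : x = 0
    · rw [hx0, h0 g hg, hπ0]
    · have hxB : x ∈ B.erase 0 :=
        Finset.mem_erase.2 ⟨hx0, hSB (by simp [hx, hx0])⟩
      have := hge (e.symm ⟨x, hxB⟩)
      simpa using this
  · left
    exact le_antisymm (h2.le_linearPerms hG h0 h3) hG

end Classification

/-! ### Groups moving the zero vector, and the full list of closed groups -/

section AffineClassification

variable {V : Type w} [AddCommGroup V] [Module (ZMod 2) V] [Infinite V]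
  {G : Subgroup (Equiv.Perm V)}

/-- By transitivity x may be taken to be 0. The closure of {0, a, b} lies in the span of a and b,
and a + b is fixed by the linear maps fixing a and b. -/
theorem ncard_algClosure_triple (hG : linearPerms V ≤ G)
    (hlin : ∀ g ∈ G, g 0 = 0 → g ∈ linearPerms V) (htrans : ∀ v, ∃ g ∈ G, g v = 0)
    {x y z : V} (hxy : x ≠ y) (hxz : x ≠ z) (hyz : y ≠ z) :
    (algClosure G ({x, y, z} : Set V)).ncard = 4 := by
  classical
  obtain ⟨g, hg, hgx⟩ := htrans x
  have ha : g y ≠ 0 := fun h => hxy (g.injective (hgx.trans h.symm))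
  have hb : g z ≠ 0 := fun h => hxz (g.injective (hgx.trans h.symm))
  have hab : g y ≠ g z := g.injective.ne hyz
  rw [← Set.ncard_image_of_injective _ g.injective, ← algClosure_image hg, Set.image_insert_eq,
    Set.image_pair, hgx]
  generalize g y = a at *
  generalize g z = b at *
  have heq : algClosure G ({0, a, b} : Set V) = (({0, a, b, a + b} : Finset V) : Set V) := by
    apply Set.Subset.antisymm
    · intro t ht
      have h1 := algClosure_subset_span hG (Set.toFinite _) ht
      rw [Submodule.span_insert_zero, SetLike.mem_coe, mem_span_pair_iff] at h1
      simpa using h1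
    · have hsub := subset_algClosure (G := G) ({0, a, b} : Set V)
      simp only [Finset.coe_insert, Finset.coe_singleton, Set.insert_subset_iff,
        Set.singleton_subset_iff] at hsub ⊢
      refine ⟨hsub.1, hsub.2.1, hsub.2.2, (Set.finite_singleton (a + b)).subset ?_⟩
      rintro t ⟨h, hh, hfix, rfl⟩
      rw [Set.mem_singleton_iff, mem_linearPerms_iff.1 (hlin h hh (hfix 0 (by simp))),
        hfix a (by simp), hfix b (by simp)]
  rw [heq, Set.ncard_coe_finset]
  have hab0 : a + b ≠ 0 := fun h =>
    hab (add_right_cancel (h.trans (add_self_of_zmod_two b).symm))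
  rw [Finset.card_insert_of_notMem, Finset.card_insert_of_notMem, Finset.card_pair]
  · simpa using ha
  · simp [hab, hb]
  · simp [ha.symm, hb.symm, hab0.symm]

/-- If one vector is 0, linearity suffices. If z = x + y, the closure lies in {0, x, y, z}, and
having four points it contains 0. Otherwise the triple is independent, and the fourth point is the
sum by exchange. -/
theorem add_add_mem_algClosure (hG : linearPerms V ≤ G)
    (hlin : ∀ g ∈ G, g 0 = 0 → g ∈ linearPerms V) (htrans : ∀ v, ∃ g ∈ G, g v = 0)
    {x y z : V} (hxy : x ≠ y) (hxz : x ≠ z) (hyz : y ≠ z) :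
    x + y + z ∈ algClosure G ({x, y, z} : Set V) := by
  classical
  have hcard := fun {x y z : V} => ncard_algClosure_triple hG hlin htrans (x := x) (y := y) (z := z)
  have hzero : ∀ a b : V, (0 : V) ≠ a → (0 : V) ≠ b → a ≠ b →
      a + b ∈ algClosure G ({0, a, b} : Set V) := by
    intro a b _ _ _
    refine (Set.finite_singleton (a + b)).subset ?_
    rintro t ⟨h, hh, hfix, rfl⟩
    rw [Set.mem_singleton_iff, mem_linearPerms_iff.1 (hlin h hh (hfix 0 (by simp))),
      hfix a (by simp), hfix b (by simp)]
  by_cases hx : x = 0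
  · subst hx
    rw [zero_add]
    exact hzero _ _ hxy hxz hyz
  by_cases hy : y = 0
  · subst hy
    rw [add_zero, Set.insert_comm]
    exact hzero _ _ hxy.symm hyz hxz
  by_cases hz : z = 0
  · subst hz
    rw [add_zero, Set.pair_comm, Set.insert_comm]
    exact hzero _ _ (Ne.symm hxz) (Ne.symm hyz) hxy
  by_cases hzxy : z = x + y
  · have hsub : algClosure G ({x, y, z} : Set V) ⊆ ({0, x, y, z} : Finset V) := by
      intro t ht
      have h1 := algClosure_subset_span hG (Set.toFinite _) ht
      have h2 : Submodule.span (ZMod 2) ({x, y, z} : Set V) ≤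
          Submodule.span (ZMod 2) ({x, y} : Set V) := by
        rw [Submodule.span_le, Set.insert_subset_iff, Set.insert_subset_iff,
          Set.singleton_subset_iff]
        exact ⟨mem_span_pair_iff.2 (by simp), mem_span_pair_iff.2 (by simp),
          mem_span_pair_iff.2 (by simp [hzxy])⟩
      have h3 := mem_span_pair_iff.1 (h2 h1)
      rw [← hzxy] at h3
      simpa using h3
    have heq := Set.eq_of_subset_of_ncard_le hsub (by
      rw [hcard hxy hxz hyz, Set.ncard_coe_finset]
      exact Finset.card_le_four) (Finset.finite_toSet _)
    rw [← hzxy, add_self_of_zmod_two, heq]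
    simp
  · have hspan : x ∉ Submodule.span (ZMod 2) ({y, z} : Set V) := by
      rw [mem_span_pair_iff]
      rintro (h | h | h | h)
      · exact hx h
      · exact hxy h
      · exact hxz h
      · refine hzxy ?_
        rw [h, add_right_comm, add_self_of_zmod_two, zero_add]
    have hspan' : y ∉ Submodule.span (ZMod 2) ({z} : Set V) := by
      rw [Submodule.mem_span_singleton]
      rintro ⟨c, rfl⟩
      rcases zmod_two_eq_zero_or_one c with rfl | rfl
      · simp at hy
      · simp at hyz
    have hind : LinearIndepOn (ZMod 2) id (({x, y, z} : Finset V) : Set V) := by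
      rw [Finset.coe_insert, Finset.coe_pair]
      refine LinearIndepOn.id_insert (LinearIndepOn.id_insert ?_ hspan') hspan
      exact LinearIndepOn.singleton (v := id) hz
    have hAcard : (algClosure G ((({x, y, z} : Finset V)) : Set V)).ncard = 4 := by
      rw [Finset.coe_insert, Finset.coe_pair]
      exact hcard hxy hxz hyz
    have hex : ∃ t ∈ algClosure G (({x, y, z} : Finset V) : Set V),
        t ∉ (({x, y, z} : Finset V) : Set V) := by
      refine Set.exists_mem_notMem_of_ncard_lt_ncard ?_ (Finset.finite_toSet _)
      rw [hAcard, Set.ncard_coe_finset]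
      exact Nat.lt_succ_of_le Finset.card_le_three
    obtain ⟨t, ht, htA⟩ := hex
    have hsum := eq_sum_of_mem_algClosure hG hind ht (by
      intro d hd
      have h3 : (insert t (({x, y, z} : Finset V).erase d)).card = 3 := by
        rw [Finset.card_insert_of_notMem fun h1 => htA (Finset.mem_of_mem_erase h1),
          Finset.card_erase_add_one hd]
        exact Finset.card_eq_three.2 ⟨x, y, z, hxy, hxz, hyz, rfl⟩
      obtain ⟨p, q, r, hpq, hpr, hqr, hT⟩ := Finset.card_eq_three.1 h3
      rw [hAcard, hT, Finset.coe_insert, Finset.coe_pair, hcard hpq hpr hqr])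
    rw [Finset.sum_insert (by simp [hxy, hxz]), Finset.sum_pair hyz, ← add_assoc] at hsum
    rw [← hsum]
    simpa using ht

/-- For distinct x, y, z the closure is {x, y, z, x + y + z}; an element of `G` maps closures to
closures, so it maps the fourth point to the fourth point. -/
theorem le_affinePerms (hG : linearPerms V ≤ G)
    (hlin : ∀ g ∈ G, g 0 = 0 → g ∈ linearPerms V) (htrans : ∀ v, ∃ g ∈ G, g v = 0) :
    G ≤ affinePerms V := by
  classical
  intro g hg
  rw [mem_affinePerms_iff]
  intro x y z
  by_cases hxy : x = y
  · rw [hxy, add_self_of_zmod_two, add_self_of_zmod_two, zero_add, zero_add]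
  by_cases hxz : x = z
  · rw [hxz, add_right_comm, add_right_comm (g z), add_self_of_zmod_two, add_self_of_zmod_two,
      zero_add, zero_add]
  by_cases hyz : y = z
  · rw [hyz, add_assoc, add_assoc, add_self_of_zmod_two, add_self_of_zmod_two, add_zero, add_zero]
  have key : ∀ x y z : V, x ≠ y → x ≠ z → y ≠ z → x + y + z ∉ ({x, y, z} : Finset V) := by
    intro x y z hxy hxz hyz hmem
    have hsum : ∀ a b : V, a + b = 0 → a = b := fun a b h =>
      add_right_cancel (h.trans (add_self_of_zmod_two b).symm)
    simp only [Finset.mem_insert, Finset.mem_singleton] at hmem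
    rcases hmem with h | h | h
    · rw [add_assoc, add_eq_left] at h
      exact hyz (hsum _ _ h)
    · rw [add_right_comm, add_eq_right] at h
      exact hxz (hsum _ _ h)
    · rw [add_eq_right] at h
      exact hxy (hsum _ _ h)
  have hg' : g x ≠ g y ∧ g x ≠ g z ∧ g y ≠ g z :=
    ⟨g.injective.ne hxy, g.injective.ne hxz, g.injective.ne hyz⟩
  obtain ⟨h1, h2, h3⟩ := hg'
  have hsub : ((insert (g x + g y + g z) {g x, g y, g z} : Finset V) : Set V) ⊆
      algClosure G ({g x, g y, g z} : Set V) := by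
    rw [Finset.coe_insert, Set.insert_subset_iff]
    refine ⟨add_add_mem_algClosure hG hlin htrans h1 h2 h3, ?_⟩
    rw [Finset.coe_insert, Finset.coe_pair]
    exact subset_algClosure _
  have heq := Set.eq_of_subset_of_ncard_le hsub (by
    rw [ncard_algClosure_triple hG hlin htrans h1 h2 h3, Set.ncard_coe_finset,
      Finset.card_insert_of_notMem (key _ _ _ h1 h2 h3),
      Finset.card_eq_three.2 ⟨_, _, _, h1, h2, h3, rfl⟩]) (finite_algClosure hG (Set.toFinite _))
  have hmem := apply_mem_algClosure_image hg (add_add_mem_algClosure hG hlin htrans hxy hxz hyz)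
  rw [Set.image_insert_eq, Set.image_pair, ← heq, Finset.mem_coe, Finset.mem_insert] at hmem
  refine hmem.resolve_right fun hmem => key x y z hxy hxz hyz ?_
  simpa using hmem

omit [Infinite V] in
theorem mem_linearPerms_of_mem_affinePerms {σ : Equiv.Perm V} (hσ : σ ∈ affinePerms V)
    (h0 : σ 0 = 0) : σ ∈ linearPerms V := by
  rw [mem_linearPerms_iff]
  intro x y
  have := mem_affinePerms_iff.1 hσ x y 0
  rwa [h0, add_zero, add_zero] at this

/-- The closed permutation groups containing the general linear group. -/
theorem exists_eq_fourGroups (hG : linearPerms V ≤ G) (hcl : IsClosedPermGroup G) :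
    ∃ i, fourGroups V i = G := by
  by_cases h0 : ∀ g ∈ G, g 0 = 0
  · rcases eq_linearPerms_or_eq_stabilizer hG hcl h0 with h | h
    · exact ⟨0, h.symm⟩
    · exact ⟨2, h.symm⟩
  push Not at h0
  obtain ⟨f, hf, hf0⟩ := h0
  have htrans : ∀ v, ∃ g ∈ G, g v = 0 := by
    intro v
    by_cases hv : v = 0
    · exact ⟨1, G.one_mem, hv⟩
    -- GL is transitive on nonzero vectors, so `σ * f` takes 0 to `v`.
    obtain ⟨σ, hσ, -, h1, -⟩ := exists_linearPerms_swap (⊥ : Submodule (ZMod 2) V)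
      (x := f 0) (y := v) hf0 hv
    refine ⟨(σ * f)⁻¹, G.inv_mem (G.mul_mem (hG hσ) hf), ?_⟩
    rw [Equiv.Perm.inv_eq_iff_eq, Equiv.Perm.mul_apply, h1]
  have hstab : linearPerms V ≤ G ⊓ MulAction.stabilizer (Equiv.Perm V) (0 : V) := fun σ hσ =>
    ⟨hG hσ, linearPerms_apply_zero hσ⟩
  have hclstab : IsClosedPermGroup (G ⊓ MulAction.stabilizer (Equiv.Perm V) (0 : V)) := by
    intro π hπ
    refine ⟨hcl π fun S => ?_, ?_⟩
    · obtain ⟨σ, hσ, h⟩ := hπ S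
      exact ⟨σ, hσ.1, h⟩
    · obtain ⟨σ, hσ, h⟩ := hπ {0}
      exact (h 0 (by simp)).symm.trans hσ.2
  rcases eq_linearPerms_or_eq_stabilizer hstab hclstab fun g hg => hg.2 with h | h
  · have hlin : ∀ g ∈ G, g 0 = 0 → g ∈ linearPerms V := fun g hg hg0 => h ▸ ⟨hg, hg0⟩
    have hle := le_affinePerms hG hlin htrans
    refine ⟨1, le_antisymm (fun α hα => ?_) hle⟩
    -- `g * α` is affine and fixes 0, so it is linear and lies in `G`.
    obtain ⟨g, hg, hgα⟩ := htrans (α 0)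
    have := hG (mem_linearPerms_of_mem_affinePerms ((affinePerms V).mul_mem (hle hg) hα) hgα)
    exact (G.mul_mem_cancel_left hg).1 this
  · refine ⟨3, (eq_top_iff.2 fun π _ => ?_).symm⟩
    obtain ⟨g, hg, hgπ⟩ := htrans (π 0)
    have : g * π ∈ G ⊓ MulAction.stabilizer (Equiv.Perm V) (0 : V) :=
      h.ge hgπ
    exact (G.mul_mem_cancel_left hg).1 this.1

omit [Infinite V] in
theorem linearPerms_le_fourGroups (i : Fin 4) : linearPerms V ≤ fourGroups V i := by
  fin_cases i
  · exact le_rfl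
  · intro σ hσ
    refine mem_affinePerms_iff.2 fun x y z => ?_
    rw [mem_linearPerms_iff.1 hσ, mem_linearPerms_iff.1 hσ]
  · exact fun σ hσ => linearPerms_apply_zero hσ
  · exact le_top

theorem fourGroups_injective : Function.Injective (fourGroups V) := by
  classical
  obtain ⟨c, hc⟩ := exists_ne (0 : V)
  -- translations
  have htr : Equiv.addRight c ∈ affinePerms V := by
    rw [mem_affinePerms_iff]
    intro x y z
    have h1 : ∀ x y z c : V, x + c + (y + c) + (z + c) = x + y + z + c + (c + c) := by
      intro x y z c
      abel
    change x + y + z + c = x + c + (y + c) + (z + c)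
    rw [h1, add_self_of_zmod_two, add_zero]
  have htr0 : Equiv.addRight c ∉ MulAction.stabilizer (Equiv.Perm V) (0 : V) := by
    intro h
    have h1 : (0 : V) + c = 0 := h
    exact hc (by simpa using h1)
  -- a transposition
  obtain ⟨A, hA, hAi⟩ := exists_linearIndepOn_card (V := V) 2
  obtain ⟨a, b, hab, rfl⟩ := Finset.card_eq_two.1 hA
  have ha : a ≠ 0 := hAi.ne_zero (by simp)
  have hb : b ≠ 0 := hAi.ne_zero (by simp)
  have hab0 : a + b ≠ 0 := fun h =>
    hab (add_right_cancel (h.trans (add_self_of_zmod_two b).symm))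
  have hsw0 : Equiv.swap a (a + b) ∈ MulAction.stabilizer (Equiv.Perm V) (0 : V) :=
    Equiv.swap_apply_of_ne_of_ne ha.symm hab0.symm
  have hsw : Equiv.swap a (a + b) ∉ affinePerms V := by
    intro h
    -- The choice makes the transposition fix both d and d + a; additivity would then give d + a = d
    -- + (a + b), so b = 0.
    obtain ⟨d, hd⟩ := Infinite.exists_notMem_finset ({a, a + b, 0, b} : Finset V)
    simp only [Finset.mem_insert, Finset.mem_singleton, not_or] at hd
    obtain ⟨h1, h2, h3, h4⟩ := hd
    have hlin := mem_linearPerms_iff.1 (mem_linearPerms_of_mem_affinePerms h hsw0) d a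
    rw [Equiv.swap_apply_left, Equiv.swap_apply_of_ne_of_ne h1 h2,
      Equiv.swap_apply_of_ne_of_ne (by simpa using h3)] at hlin
    · rw [add_right_inj] at hlin
      exact hb (by simpa using hlin.symm)
    · rw [add_comm, Ne, add_right_inj]
      exact h4
  have hle : ∀ σ, σ ∈ linearPerms V → σ ∈ affinePerms V := linearPerms_le_fourGroups 1
  have hst : ∀ σ, σ ∈ linearPerms V → σ ∈ MulAction.stabilizer (Equiv.Perm V) (0 : V) :=
    linearPerms_le_fourGroups 2
  have h01 : linearPerms V ≠ affinePerms V := fun h => htr0 (hst _ (h ▸ htr))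
  have h02 : linearPerms V ≠ MulAction.stabilizer (Equiv.Perm V) (0 : V) := fun h =>
    hsw (hle _ (h ▸ hsw0))
  have h03 : linearPerms V ≠ ⊤ := fun h => htr0 (hst _ (h ▸ Subgroup.mem_top _))
  have h12 : affinePerms V ≠ MulAction.stabilizer (Equiv.Perm V) (0 : V) := fun h =>
    htr0 (h ▸ htr)
  have h13 : affinePerms V ≠ ⊤ := fun h => hsw (h ▸ Subgroup.mem_top _)
  have h23 : MulAction.stabilizer (Equiv.Perm V) (0 : V) ≠ ⊤ := fun h =>
    htr0 (h ▸ Subgroup.mem_top _)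
  intro i j hij
  fin_cases i <;> fin_cases j <;> first
    | rfl
    | exact (h01 hij).elim
    | exact (h01 hij.symm).elim
    | exact (h02 hij).elim
    | exact (h02 hij.symm).elim
    | exact (h03 hij).elim
    | exact (h03 hij.symm).elim
    | exact (h12 hij).elim
    | exact (h12 hij.symm).elim
    | exact (h13 hij).elim
    | exact (h13 hij.symm).elim
    | exact (h23 hij).elim
    | exact (h23 hij.symm).elim

end AffineClassification

/-! ### Back-and-forth -/

/-- A back-and-forth system of partial bijections of a countable set yields a permutation. -/
theorem exists_perm_of_backAndForth {M : Type w} [Countable M] [Nonempty M]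
    (E : Set (Set (M × M)))
    (hE : ∀ p ∈ E, ∀ u ∈ p, ∀ v ∈ p, u.1 = v.1 ↔ u.2 = v.2)
    (hforth : ∀ p ∈ E, ∀ x, ∃ q ∈ E, p ⊆ q ∧ ∃ y, (x, y) ∈ q)
    (hback : ∀ p ∈ E, ∀ y, ∃ q ∈ E, p ⊆ q ∧ ∃ x, (x, y) ∈ q)
    {p₀ : Set (M × M)} (hp₀ : p₀ ∈ E) :
    ∃ σ : Equiv.Perm M, (∀ u ∈ p₀, σ u.1 = u.2) ∧
      ∀ F : Finset M, ∃ p ∈ E, ∀ x ∈ F, (x, σ x) ∈ p := by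
  have hstep : ∀ (p : E) (x : M), ∃ q : E, p.1 ⊆ q.1 ∧
      (∃ y, (x, y) ∈ q.1) ∧ ∃ y, (y, x) ∈ q.1 := by
    rintro ⟨p, hp⟩ x
    obtain ⟨q, hq, hpq, y, hy⟩ := hforth p hp x
    obtain ⟨r, hr, hqr, z, hz⟩ := hback q hq x
    exact ⟨⟨r, hr⟩, hpq.trans hqr, ⟨y, hqr hy⟩, z, hz⟩
  choose next hnext hleft hright using hstep
  obtain ⟨e, he⟩ := exists_surjective_nat M
  -- Stage k + 1 puts the k-th point of the enumeration into both the domain and the range.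
  let seq : ℕ → E := fun k => Nat.rec ⟨p₀, hp₀⟩ (fun k p => next p (e k)) k
  have hmono : ∀ {k l : ℕ}, k ≤ l → (seq k).1 ⊆ (seq l).1 := by
    intro k l hkl
    induction l, hkl using Nat.le_induction with
    | base => exact subset_rfl
    | succ l _ ih => exact ih.trans (hnext (seq l) (e l))
  have hdom : ∀ x, ∃ y k, (x, y) ∈ (seq k).1 := by
    intro x
    obtain ⟨k, rfl⟩ := he x
    obtain ⟨y, hy⟩ := hleft (seq k) (e k)
    exact ⟨y, k + 1, hy⟩
  have hran : ∀ y, ∃ x k, (x, y) ∈ (seq k).1 := by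
    intro y
    obtain ⟨k, rfl⟩ := he y
    obtain ⟨x, hx⟩ := hright (seq k) (e k)
    exact ⟨x, k + 1, hx⟩
  choose f kf hf using hdom
  choose g kg hg using hran
  have hcomp : ∀ {k l : ℕ} {u v : M × M}, u ∈ (seq k).1 →
      v ∈ (seq l).1 → (u.1 = v.1 ↔ u.2 = v.2) := fun {k l u v} hu hv =>
    hE _ (seq (max k l)).2 u (hmono (le_max_left k l) hu) v (hmono (le_max_right k l) hv)
  refine ⟨⟨f, g, fun x => ?_, fun y => ?_⟩, fun u hu => ?_, fun F => ?_⟩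
  · exact (hcomp (hg (f x)) (hf x)).2 rfl
  · exact (hcomp (hf (g y)) (hg y)).1 rfl
  · have h0 : u ∈ (seq 0).1 := hu
    exact (hcomp (l := 0) (hf u.1) h0).1 rfl
  · exact ⟨_, (seq (F.sup kf)).2, fun x hx => hmono (Finset.le_sup hx) (hf x)⟩

/-! ### Automorphisms and definable sets -/

namespace StructureOn

variable {M : Type w} {A : StructureOn.{u, v, w} M}

theorem mem_aut_iff {σ : Equiv.Perm M} : σ ∈ A.aut ↔
    (∀ (n : ℕ) (f : A.lang.Functions n) (x : Fin n → M),
      σ (A.str.funMap f x) = A.str.funMap f (σ ∘ x)) ∧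
    ∀ (n : ℕ) (r : A.lang.Relations n) (x : Fin n → M),
      A.str.RelMap r (σ ∘ x) ↔ A.str.RelMap r x := by
  let _ := A.str
  constructor
  · rintro ⟨e, rfl⟩
    exact ⟨fun n f x => e.map_fun' f x, fun n r x => e.map_rel' r x⟩
  · rintro ⟨hf, hr⟩
    exact ⟨{ toEquiv := σ, map_fun' := fun {n} f x => hf n f x,
             map_rel' := fun {n} r x => hr n r x }, rfl⟩

theorem Defines.comp_mem_iff {α : Type} {s : Set (α → M)} (hs : A.Defines s)
    {σ : Equiv.Perm M} (hσ : σ ∈ A.aut) (x : α → M) : σ ∘ x ∈ s ↔ x ∈ s := by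
  let _ := A.str
  obtain ⟨e, rfl⟩ := hσ
  obtain ⟨φ, rfl⟩ := Set.empty_definable_iff.1 hs
  exact FirstOrder.Language.StrongHomClass.realize_formula e φ

theorem isClosedPermGroup_aut : IsClosedPermGroup A.aut := by
  classical
  intro π hπ
  rw [mem_aut_iff]
  constructor
  · intro n f x
    obtain ⟨σ, hσ, h⟩ := hπ (insert (A.str.funMap f x) (Finset.univ.image x))
    rw [← h _ (Finset.mem_insert_self _ _), (mem_aut_iff.1 hσ).1]
    congr 1
    ext i
    exact h _ (by simp)
  · intro n r x
    obtain ⟨σ, hσ, h⟩ := hπ (Finset.univ.image x)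
    have : π ∘ x = σ ∘ x := by
      ext i
      exact (h _ (by simp)).symm
    rw [this]
    exact (mem_aut_iff.1 hσ).2 n r x

theorem defines_graph {n : ℕ} (f : A.lang.Functions n) :
    A.Defines {x : Fin (n + 1) → M | A.str.funMap f (Fin.init x) = x (Fin.last n)} := by
  let _ := A.str
  refine Set.empty_definable_iff.2 ⟨(FirstOrder.Language.Term.func f
    fun i => FirstOrder.Language.Term.var i.castSucc).equal
      (FirstOrder.Language.Term.var (Fin.last n)), ?_⟩
  ext x
  simp only [Set.mem_ofPred_eq, FirstOrder.Language.Formula.realize_equal,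
    FirstOrder.Language.Term.realize_func, FirstOrder.Language.Term.realize_var]
  rfl

theorem defines_rel {n : ℕ} (r : A.lang.Relations n) :
    A.Defines {x : Fin n → M | A.str.RelMap r x} := by
  let _ := A.str
  refine Set.empty_definable_iff.2 ⟨r.formula fun i => FirstOrder.Language.Term.var i, ?_⟩
  ext x
  simp only [Set.mem_ofPred_eq, FirstOrder.Language.Formula.realize_rel,
    FirstOrder.Language.Term.realize_var]

theorem defines_eq {α : Type} (i j : α) : A.Defines {x : α → M | x i = x j} := by
  let _ := A.str
  refine Set.empty_definable_iff.2 ⟨(FirstOrder.Language.Term.var i).equal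
    (FirstOrder.Language.Term.var j), ?_⟩
  ext x
  simp only [Set.mem_ofPred_eq, FirstOrder.Language.Formula.realize_equal,
    FirstOrder.Language.Term.realize_var]

theorem defines_sInter {α : Type} {F : Set (Set (α → M))} (hF : F.Finite)
    (h : ∀ s ∈ F, A.Defines s) : A.Defines (⋂₀ F) := by
  let _ := A.str
  have := hF.to_subtype
  rw [Set.sInter_eq_iInter]
  exact Set.definable_iInter_of_finite fun s => h s s.2

theorem defines_sUnion {α : Type} {F : Set (Set (α → M))} (hF : F.Finite)
    (h : ∀ s ∈ F, A.Defines s) : A.Defines (⋃₀ F) := by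
  let _ := A.str
  have := hF.to_subtype
  rw [Set.sUnion_eq_iUnion]
  exact Set.definable_iUnion_of_finite fun s => h s s.2

/-- A permutation preserving all definable sets of tuples is an automorphism. -/
theorem mem_aut_of_comp_mem_iff {σ : Equiv.Perm M}
    (h : ∀ (n : ℕ) (s : Set (Fin n → M)), A.Defines s → ∀ x, σ ∘ x ∈ s ↔ x ∈ s) :
    σ ∈ A.aut := by
  refine mem_aut_iff.2 ⟨fun n f x => ?_, fun n r x => h n _ (defines_rel r) x⟩
  have h1 := (h _ _ (defines_graph f) (Fin.snoc x (A.str.funMap f x) : Fin (n + 1) → M)).2 (by simp)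
  rw [Fin.comp_snoc, Set.mem_ofPred_eq, Fin.init_snoc, Fin.snoc_last] at h1
  exact h1.symm

variable (A) in
/-- Two tuples have the same type if they belong to the same definable sets. -/
def SameType {n : ℕ} (a b : Fin n → M) : Prop :=
  ∀ s : Set (Fin n → M), A.Defines s → (a ∈ s ↔ b ∈ s)

theorem SameType.symm {n : ℕ} {a b : Fin n → M} (h : A.SameType a b) : A.SameType b a :=
  fun s hs => (h s hs).symm

theorem SameType.comp {n m : ℕ} {a b : Fin n → M} (h : A.SameType a b) (f : Fin m → Fin n) :
    A.SameType (a ∘ f) (b ∘ f) := by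
  let _ := A.str
  exact fun s hs => h _ (Set.Definable.preimage_comp f hs)

section Oligomorphic

variable (hA : ∀ n, {s : Set (Fin n → M) | A.Defines s}.Finite)
include hA

/-- If there are only finitely many definable sets of `n`-tuples, then types are isolated. -/
theorem exists_defines_isolating {n : ℕ} (a : Fin n → M) :
    ∃ s, A.Defines s ∧ a ∈ s ∧ ∀ b ∈ s, A.SameType a b := by
  refine ⟨⋂₀ {s | A.Defines s ∧ a ∈ s},
    defines_sInter ((hA n).subset fun s hs => hs.1) fun s hs => hs.1, fun s hs => hs.2, ?_⟩
  intro b hb s hs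
  refine ⟨fun has => hb s ⟨hs, has⟩, fun hbs => ?_⟩
  by_contra has
  let _ := A.str
  exact hb sᶜ ⟨Set.Definable.compl hs, has⟩ hbs

/-- The projection of a set isolating the type of the extended tuple is definable and contains `a`,
hence `b`; a preimage of `b` supplies y. -/
theorem SameType.exists_snoc {n : ℕ} {a b : Fin n → M} (h : A.SameType a b) (x : M) :
    ∃ y, A.SameType (Fin.snoc a x : Fin (n + 1) → M) (Fin.snoc b y : Fin (n + 1) → M) := by
  let _ := A.str
  obtain ⟨s, hs, has, hiso⟩ := exists_defines_isolating hA (Fin.snoc a x : Fin (n + 1) → M)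
  have hproj : A.Defines ((fun g : Fin (n + 1) → M => g ∘ Fin.castSucc) '' s) :=
    Set.Definable.image_comp hs Fin.castSucc
  have hinit : ∀ (c : Fin n → M) (z : M), (Fin.snoc c z : Fin (n + 1) → M) ∘ Fin.castSucc = c := by
    intro c z
    ext i
    simp
  obtain ⟨c, hc, rfl⟩ := (h _ hproj).1 ⟨_, has, hinit a x⟩
  refine ⟨c (Fin.last n), hiso _ ?_⟩
  have : (Fin.snoc (c ∘ Fin.castSucc) (c (Fin.last n)) : Fin (n + 1) → M) = c :=
    Fin.snoc_init_self c
  rwa [this]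

/-- Over a countable set, tuples of the same type are conjugate under the automorphism group. -/
theorem SameType.exists_mem_aut [Countable M] [Nonempty M] {n : ℕ} {a b : Fin n → M}
    (h : A.SameType a b) : ∃ σ ∈ A.aut, σ ∘ a = b := by
  classical
  -- Finite partial maps between tuples of the same type; definability of equality makes them well
  -- defined and injective.
  let E : Set (Set (M × M)) := {p | ∃ (m : ℕ) (c d : Fin m → M), A.SameType c d ∧
    p = Set.range fun i => (c i, d i)}
  have hsub : ∀ {m : ℕ} (c d : Fin m → M) (x y : M), (Set.range fun i => (c i, d i)) ⊆
      Set.range fun i => ((Fin.snoc c x : Fin (m + 1) → M) i, (Fin.snoc d y : Fin (m + 1) → M) i) := by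
    rintro m c d x y _ ⟨i, rfl⟩
    exact ⟨i.castSucc, by simp⟩
  obtain ⟨σ, hσ₀, hσ⟩ := exists_perm_of_backAndForth E (p₀ := Set.range fun i => (a i, b i))
    (by
      rintro _ ⟨m, c, d, hcd, rfl⟩ _ ⟨i, rfl⟩ _ ⟨j, rfl⟩
      exact hcd _ (defines_eq i j))
    (by
      rintro _ ⟨m, c, d, hcd, rfl⟩ x
      obtain ⟨y, hy⟩ := hcd.exists_snoc hA x
      exact ⟨_, ⟨m + 1, _, _, hy, rfl⟩, hsub c d x y, y, Fin.last m, by simp⟩)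
    (by
      rintro _ ⟨m, c, d, hcd, rfl⟩ y
      obtain ⟨x, hx⟩ := hcd.symm.exists_snoc hA y
      exact ⟨_, ⟨m + 1, _, _, hx.symm, rfl⟩, hsub c d x y, x, Fin.last m, by simp⟩)
    ⟨n, a, b, h, rfl⟩
  refine ⟨σ, mem_aut_of_comp_mem_iff fun m s hs x => ?_, ?_⟩
  · obtain ⟨_, ⟨k, c, d, hcd, rfl⟩, hx⟩ := hσ (Finset.univ.image x)
    have hx' : ∀ i, ∃ j, (c j, d j) = (x i, σ (x i)) := fun i => hx (x i) (by simp)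
    choose j hj using hx'
    have hc : c ∘ j = x := funext fun i => (Prod.ext_iff.1 (hj i)).1
    have hd : d ∘ j = σ ∘ x := funext fun i => (Prod.ext_iff.1 (hj i)).2
    rw [← hd, ← hc]
    exact ((hcd.comp j) s hs).symm
  · ext i
    exact hσ₀ (a i, b i) ⟨i, rfl⟩

/-- The theorem of Ryll-Nardzewski: if a countable structure has finitely many definable sets of
`n`-tuples for each `n`, then the sets that are invariant under automorphisms are definable. -/
theorem defines_of_invariant [Countable M] [Nonempty M] {n : ℕ} {s : Set (Fin n → M)}
    (hs : ∀ σ ∈ A.aut, ∀ x ∈ s, σ ∘ x ∈ s) : A.Defines s := by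
  have : s = ⋃₀ {t | A.Defines t ∧ t ⊆ s} := by
    apply Set.Subset.antisymm
    · intro a ha
      obtain ⟨t, ht, hat, hiso⟩ := exists_defines_isolating hA a
      refine ⟨t, ⟨ht, fun b hb => ?_⟩, hat⟩
      obtain ⟨σ, hσ, rfl⟩ := (hiso b hb).exists_mem_aut hA
      exact hs σ hσ a ha
    · exact Set.sUnion_subset fun t ht => ht.2
  rw [this]
  exact defines_sUnion ((hA n).subset fun t ht => ht.1) fun t ht => ht.1

end Oligomorphic

end StructureOn

/-! ### Overgroups of the linear group are oligomorphic -/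

section Oligomorphic

variable {V : Type w} [AddCommGroup V] [Module (ZMod 2) V]

/-- Tuples that satisfy the same linear relations are conjugate under the linear group. -/
theorem exists_linearPerms_comp_eq {n : ℕ} (a b : Fin n → V)
    (h : ∀ c : Fin n → ZMod 2, ∑ i, c i • a i = 0 ↔ ∑ i, c i • b i = 0) :
    ∃ σ ∈ linearPerms V, σ ∘ a = b := by
  induction n with
  | zero => exact ⟨1, one_mem _, funext fun i => i.elim0⟩
  | succ n ih =>
    have hiff : ∀ x y : V, x + y = 0 ↔ y = x := by
      intro x y
      rw [add_eq_zero_iff_eq_neg, ZModModule.neg_eq_self, eq_comm]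
    obtain ⟨g, hg, hgab⟩ := ih (a ∘ Fin.castSucc) (b ∘ Fin.castSucc) fun c => by
      have := h (Fin.snoc c 0)
      simpa [Fin.sum_univ_castSucc] using this
    -- Relations with last coefficient 1 express the last vector through the others.
    have hlast : ∀ c : Fin n → ZMod 2, a (Fin.last n) = ∑ i, c i • a i.castSucc ↔
        b (Fin.last n) = ∑ i, c i • b i.castSucc := by
      intro c
      have := h (Fin.snoc c 1)
      simpa [Fin.sum_univ_castSucc, hiff] using this
    have hgi : ∀ i : Fin n, g (a i.castSucc) = b i.castSucc := congrFun hgab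
    have hgsum : ∀ c : Fin n → ZMod 2,
        g (∑ i, c i • a i.castSucc) = ∑ i, c i • b i.castSucc := by
      intro c
      simp_rw [← hgi]
      obtain ⟨e, rfl⟩ := hg
      change e _ = ∑ i, c i • e _
      simp
    let W := Submodule.span (ZMod 2) (Set.range fun i : Fin n => b i.castSucc)
    have hmem : ∀ y, y ∈ W ↔ ∃ c : Fin n → ZMod 2, ∑ i, c i • b i.castSucc = y := fun y =>
      Submodule.mem_span_range_iff_exists_fun _
    by_cases hx : g (a (Fin.last n)) ∈ W
    · obtain ⟨c, hc⟩ := (hmem _).1 hx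
      rw [← hgsum] at hc
      have hb := (hlast c).1 (g.injective hc).symm
      refine ⟨g, hg, funext fun i => Fin.lastCases ?_ hgi i⟩
      rw [hb, ← hgsum, hc, Function.comp_apply]
    by_cases hy : b (Fin.last n) ∈ W
    · obtain ⟨c, hc⟩ := (hmem _).1 hy
      refine (hx ((hmem _).2 ⟨c, ?_⟩)).elim
      rw [(hlast c).2 hc.symm, hgsum]
    obtain ⟨σ, hσ, hfix, hxy, -⟩ := exists_linearPerms_swap W hx hy
    refine ⟨σ * g, mul_mem hσ hg, funext fun i => Fin.lastCases hxy (fun i => ?_) i⟩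
    change σ (g (a i.castSucc)) = _
    rw [hgi]
    exact hfix _ (Submodule.subset_span ⟨i, rfl⟩)

/-- An invariant set is a union of orbits, and an orbit is determined by its set of linear
relations, a subset of the finite set 𝔽₂ⁿ. -/
theorem finite_setOf_linearPerms_invariant (n : ℕ) :
    {s : Set (Fin n → V) | ∀ σ ∈ linearPerms V, ∀ x ∈ s, σ ∘ x ∈ s}.Finite := by
  let K : (Fin n → V) → Set (Fin n → ZMod 2) := fun a => {c | ∑ i, c i • a i = 0}
  refine Set.Finite.of_finite_image (f := fun s => K '' s) (Set.toFinite _) ?_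
  have hsub : ∀ s t : Set (Fin n → V), (∀ σ ∈ linearPerms V, ∀ x ∈ t, σ ∘ x ∈ t) →
      K '' s = K '' t → s ⊆ t := by
    intro s t ht hst a ha
    obtain ⟨b, hb, hab⟩ : K a ∈ K '' t := hst ▸ Set.mem_image_of_mem K ha
    obtain ⟨σ, hσ, rfl⟩ := exists_linearPerms_comp_eq b a fun c => Set.ext_iff.1 hab c
    exact ht σ hσ b hb
  exact fun s hs t ht hst => (hsub s t ht hst).antisymm (hsub t s hs hst.symm)

theorem StructureOn.defines_of_linearPerms_le_aut [Countable V] {A : StructureOn.{u, v, w} V}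
    (hA : linearPerms V ≤ A.aut) {n : ℕ} {s : Set (Fin n → V)}
    (hs : ∀ σ ∈ A.aut, ∀ x ∈ s, σ ∘ x ∈ s) : A.Defines s := by
  refine StructureOn.defines_of_invariant (fun m => ?_) hs
  exact (finite_setOf_linearPerms_invariant m).subset fun t ht σ hσ x hx =>
    (StructureOn.Defines.comp_mem_iff ht (hA hσ) x).2 hx

end Oligomorphic

/-! ### Reducts and inclusion of automorphism groups -/

namespace StructureOn

theorem IsReductOf.aut_le {M : Type w} {A : StructureOn.{u, v, w} M}
    {B : StructureOn.{u', v', w} M} (h : B.IsReductOf A) : A.aut ≤ B.aut := by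
  intro σ hσ
  refine mem_aut_iff.2 ⟨fun n f x => ?_, fun n r x => (h.2 n r).comp_mem_iff hσ x⟩
  have h1 := ((h.1 n f).comp_mem_iff hσ (Fin.snoc x (B.str.funMap f x) : Fin (n + 1) → M)).2
    (by simp)
  rw [Fin.comp_snoc, Set.mem_ofPred_eq, Fin.init_snoc, Fin.snoc_last] at h1
  exact h1.symm

variable {V : Type w} [AddCommGroup V] [Module (ZMod 2) V]

theorem isReductOf_of_aut_le [Countable V] {A : StructureOn.{u, v, w} V}
    {B : StructureOn.{u', v', w} V} (hA : linearPerms V ≤ A.aut) (h : A.aut ≤ B.aut) :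
    B.IsReductOf A :=
  ⟨fun _ f => defines_of_linearPerms_le_aut hA fun _ hσ x hx =>
      ((defines_graph f).comp_mem_iff (h hσ) x).2 hx,
    fun _ r => defines_of_linearPerms_le_aut hA fun _ hσ x hx =>
      ((defines_rel r).comp_mem_iff (h hσ) x).2 hx⟩

theorem interdefinable_iff_aut_eq [Countable V] {A : StructureOn.{u, v, w} V}
    {B : StructureOn.{u', v', w} V} (hA : linearPerms V ≤ A.aut) (hB : linearPerms V ≤ B.aut) :
    A.Interdefinable B ↔ A.aut = B.aut :=
  ⟨fun h => h.2.aut_le.antisymm h.1.aut_le,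
    fun h => ⟨isReductOf_of_aut_le hB h.ge, isReductOf_of_aut_le hA h.le⟩⟩

end StructureOn

/-! ### The automorphism groups of the four structures -/

section FourStructures

variable {V : Type w} [AddCommGroup V] [Module (ZMod 2) V]

theorem aut_vectorSpaceStructure : (vectorSpaceStructure V).aut = linearPerms V := by
  ext σ
  rw [StructureOn.mem_aut_iff]
  constructor
  · intro h
    exact mem_linearPerms_iff.2 fun x y => h.1 2 VecFunctions.add ![x, y]
  · intro h
    refine ⟨fun n f x => ?_, fun n r => r.elim⟩
    obtain ⟨e, rfl⟩ := h
    change VecFunctions n at f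
    cases f with
    | zero => exact map_zero e
    | neg => exact map_neg e (x 0)
    | smul c => exact map_smul e c (x 0)
    | add => exact map_add e (x 0) (x 1)

theorem aut_affineSpaceStructure : (affineSpaceStructure V).aut = affinePerms V := by
  ext σ
  rw [StructureOn.mem_aut_iff, mem_affinePerms_iff]
  constructor
  · intro h x y z
    exact h.1 3 AffFunctions.add₃ ![x, y, z]
  · intro h
    refine ⟨fun n f x => ?_, fun n r => r.elim⟩
    change AffFunctions n at f
    cases f with
    | add₃ => exact h (x 0) (x 1) (x 2)

omit [Module (ZMod 2) V] in
theorem aut_pointedSetStructure :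
    (pointedSetStructure V).aut = MulAction.stabilizer (Equiv.Perm V) (0 : V) := by
  ext σ
  rw [StructureOn.mem_aut_iff]
  constructor
  · intro h
    exact (h.2 1 UnaryRelations.pred ![0]).2 rfl
  · intro h
    have h0 : σ 0 = 0 := h
    refine ⟨fun n f => f.elim, fun n r x => ?_⟩
    change UnaryRelations n at r
    cases r with
    | pred =>
      change σ (x 0) = 0 ↔ x 0 = 0
      exact ⟨fun h1 => σ.injective (h1.trans h0.symm), fun h1 => h1 ▸ h0⟩

omit [AddCommGroup V] [Module (ZMod 2) V] in
theorem aut_trivialStructure : (trivialStructure V).aut = ⊤ := by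
  rw [eq_top_iff]
  exact fun σ _ => StructureOn.mem_aut_iff.2 ⟨fun n f => f.elim, fun n r => r.elim⟩

theorem aut_fourStructures (i : Fin 4) : (fourStructures V i).aut = fourGroups V i := by
  fin_cases i
  · exact aut_vectorSpaceStructure
  · exact aut_affineSpaceStructure
  · exact aut_pointedSetStructure
  · exact aut_trivialStructure

end FourStructures

/-! ### The classification of groups and reducts -/

theorem mainTheorem1 {V : Type w} [AddCommGroup V] [Module (ZMod 2) V]
    (hV : Module.rank (ZMod 2) V = Cardinal.aleph0) :
    -- the closed groups between `GL` and `Sym` are exactly the four listed, pairwise distinct, ones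
    ({G : Subgroup (Equiv.Perm V) | linearPerms V ≤ G ∧ IsClosedPermGroup G} =
        Set.range (fourGroups V) ∧
      Function.Injective (fourGroups V)) ∧
    -- the four structures are reducts of the vector space, they correspond to the four groups,
    -- and no two of them are interdefinable
    (∀ i, (fourStructures V i).IsReductOf (vectorSpaceStructure V)) ∧
    (∀ i, (fourStructures V i).aut = fourGroups V i) ∧
    (∀ i j, (fourStructures V i).Interdefinable (fourStructures V j) → i = j) ∧
    -- every reduct of the vector space is interdefinable with exactly one of them, namely the
    -- one that has the same automorphism group
    (∀ R : StructureOn.{u, v, w} V, R.IsReductOf (vectorSpaceStructure V) →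
      (∃! i, R.Interdefinable (fourStructures V i)) ∧
      ∀ i, R.Interdefinable (fourStructures V i) ↔ R.aut = fourGroups V i) := by
  have hinf : Infinite V := by
    by_contra hfin
    rw [not_infinite_iff_finite] at hfin
    exact (Module.rank_lt_aleph0_iff.2 (Module.Finite.of_finite (R := ZMod 2) (M := V))).ne hV
  -- V is identified with the finitely supported functions on a countable basis.
  have hcount : Countable V := by
    let b := Module.Basis.ofVectorSpace (ZMod 2) V
    have : Countable (Module.Basis.ofVectorSpaceIndex (ZMod 2) V) := by
      rw [← Cardinal.mk_le_aleph0_iff, b.mk_eq_rank'', hV]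
    exact b.repr.toEquiv.countable_iff.2 inferInstance
  have hle : ∀ i, linearPerms V ≤ (fourStructures V i).aut := fun i =>
    (linearPerms_le_fourGroups i).trans (aut_fourStructures i).ge
  refine ⟨⟨?_, fourGroups_injective⟩, fun i => ?_, aut_fourStructures, fun i j hij => ?_,
    fun R hR => ?_⟩
  · apply Set.Subset.antisymm
    · rintro G ⟨hG, hcl⟩
      exact exists_eq_fourGroups hG hcl
    · rintro _ ⟨i, rfl⟩
      refine ⟨linearPerms_le_fourGroups i, ?_⟩
      rw [← aut_fourStructures]
      exact StructureOn.isClosedPermGroup_aut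
  · exact StructureOn.isReductOf_of_aut_le aut_vectorSpaceStructure.ge
      (aut_vectorSpaceStructure.le.trans (hle i))
  · have := (StructureOn.interdefinable_iff_aut_eq (hle i) (hle j)).1 hij
    rw [aut_fourStructures, aut_fourStructures] at this
    exact fourGroups_injective this
  · have hGL : linearPerms V ≤ R.aut := aut_vectorSpaceStructure.ge.trans hR.aut_le
    have hiff : ∀ i, R.Interdefinable (fourStructures V i) ↔ R.aut = fourGroups V i := by
      intro i
      rw [StructureOn.interdefinable_iff_aut_eq hGL (hle i), aut_fourStructures]
    obtain ⟨i, hi⟩ := exists_eq_fourGroups hGL StructureOn.isClosedPermGroup_aut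
    exact ⟨⟨i, (hiff i).2 hi.symm, fun j hj =>
      fourGroups_injective (((hiff j).1 hj).symm.trans hi.symm)⟩, hiff⟩
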